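/- Let $V$ be a nonempty finite set and let $X$ be a simplicial complex with vertex set $V$, i.e. a collection of nonempty subsets of $V$ that contains $\{v\}$ for all $v\in V$ and contains every nonempty subset of each of its members. No purity of $X$ is assumed. For $k\ge 0$ let $X_k$ be the set of $\sigma\in X$ with $\#\sigma=k+1$, and put $X_{-1}:=\{\emptyset\}$. Let $\beta_k(X)=\dim_{\mathbb R}(\ker\partial_k/\operatorname{im}\partial_{k+1})$, $k\ge 0$, be the reduced Betti numbers of $X$ over $\mathbb R$: they are computed from the oriented simplicial chain spaces $C_k(X)$ with the usual boundary maps $\partial_k\langle v_0,\dots,v_k\rangle=\sum_{i=0}^k(-1)^i\langle v_0,\dots,\widehat{v_i},\dots,v_k\rangle$ for $k\ge1$, $C_{-1}(X)=\mathbb R$ and $\partial_0\langle v\rangle=1$. For $\tau\in X\cup\{\emptyset\}$ let $\operatorname{lk}_X(\tau):=\{\sigma\in X : \tau\cap\sigma=\emptyset,\ \tau\cup\sigma\in X\}$, which is empty or a simplicial complex, and let $\operatorname{lk}_X(\tau)^{(1)}$ be its one-dimensional skeleton, regarded as a graph. For a finite simple graph $G$ on a nonempty vertex set $W$, define the matrix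 $A[G]=(a_{vw})_{v,w\in W}$ by $a_{vw}=1/\deg(v)$ if $w$ is adjacent to $v$, $a_{vv}=1$ if $v$ is isolated, and $a_{vw}=0$ otherwise. Let $\mathcal L[G]:=I_W-A[G]$ be the Laplacian of the simple random walk on $G$; all its eigenvalues $\lambda_1,\dots,\lambda_{\#W}$ (listed with multiplicity) are real. For $a\ge 0$ put $\gamma(G;a):=\#\{i : \lambda_i\le a\}-1$, and put $\gamma(\emptyset;a):=0$ for the graph without vertices. Then, for every integer $D\ge 1$, $$\beta_{D-1}(X)\ \le\ \sum_{\tau\in X_{D-2}}\gamma\bigl(\operatorname{lk}_X(\tau)^{(1)};\,1-D^{-1}\bigr).$$ -/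

import Mathlib

namespace PreAbstractSimplicialComplex

variable {V : Type*}

/-- `σ` is a simplex of `K`, where `∅` is by convention the unique simplex of dimension `-1`. -/
def IsSimplex (K : PreAbstractSimplicialComplex V) (σ : Finset V) : Prop :=
  σ = ∅ ∨ σ ∈ K.faces

theorem IsSimplex.mono {K : PreAbstractSimplicialComplex V} {σ τ : Finset V}
    (h : K.IsSimplex σ) (hτ : τ ⊆ σ) : K.IsSimplex τ := by
  rcases h with rfl | h
  · exact Or.inl (Finset.subset_empty.mp hτ)
  · rcases Finset.eq_empty_or_nonempty τ with h0 | h0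
    · exact Or.inl h0
    · exact Or.inr ((K.isRelLowerSet_faces h).2 hτ h0)

open Classical in
/-- The set `K_k` of simplices of dimension `k`, `k ≥ -1` an integer; `K_{-1} = {∅}`. -/
noncomputable def simplices [Fintype V] (K : PreAbstractSimplicialComplex V) (k : ℤ) :
    Finset (Finset V) :=
  Finset.univ.filter fun σ => K.IsSimplex σ ∧ (σ.card : ℤ) - 1 = k

/-- Ordered simplices of `K` with `n` vertices, i.e. sequences `(v₀, …, v_{n-1})` of distinct
vertices that span a simplex of dimension `n - 1`. For `n = 0` there is only the empty sequence. -/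
def OrderedSimplex (K : PreAbstractSimplicialComplex V) (n : ℕ) : Type _ :=
  {s : Fin n ↪ V // K.IsSimplex (Finset.univ.map s)}

namespace OrderedSimplex

variable {K : PreAbstractSimplicialComplex V} {n : ℕ}

/-- The reordered simplex `(v_{ξ(0)}, …, v_{ξ(n-1)})`. -/
def perm (s : K.OrderedSimplex n) (ξ : Equiv.Perm (Fin n)) : K.OrderedSimplex n :=
  ⟨ξ.toEmbedding.trans s.1, s.2.mono (by
    intro v
    simp only [Finset.mem_map, Finset.mem_univ, true_and]
    rintro ⟨j, rfl⟩
    exact ⟨_, rfl⟩)⟩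

/-- The face obtained by omitting the vertex `v_i`. -/
def face (s : K.OrderedSimplex (n + 1)) (i : Fin (n + 1)) : K.OrderedSimplex n :=
  ⟨(Fin.succAboveEmb i).trans s.1, s.2.mono (by
    intro v
    simp only [Finset.mem_map, Finset.mem_univ, true_and]
    rintro ⟨j, rfl⟩
    exact ⟨_, rfl⟩)⟩

end OrderedSimplex

/-- The relations `(v_{ξ(0)}, …, v_{ξ(n-1)}) = sgn(ξ) (v₀, …, v_{n-1})` imposed on real linear
combinations of ordered simplices. -/
noncomputable def orientationRel (K : PreAbstractSimplicialComplex V) (n : ℕ) :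
    Submodule ℝ (K.OrderedSimplex n →₀ ℝ) :=
  Submodule.span ℝ
    {c | ∃ (s : K.OrderedSimplex n) (ξ : Equiv.Perm (Fin n)),
      c = Finsupp.single (s.perm ξ) 1 - Finsupp.single s ((Equiv.Perm.sign ξ : ℤ) : ℝ)}

/-- `K.Chains n` is the space `C_{n-1}(K)` of real oriented simplicial chains of dimension `n - 1`,
spanned by the oriented simplices with `n` vertices. In particular `K.Chains 0 = C_{-1}(K) ≅ ℝ`. -/
abbrev Chains (K : PreAbstractSimplicialComplex V) (n : ℕ) : Type _ :=
  (K.OrderedSimplex n →₀ ℝ) ⧸ K.orientationRel n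

/-- The oriented simplex `⟨v₀, …, v_{n-1}⟩`, as a chain. -/
noncomputable def oriented {K : PreAbstractSimplicialComplex V} {n : ℕ} (s : K.OrderedSimplex n) :
    K.Chains n :=
  (K.orientationRel n).mkQ (Finsupp.single s 1)

theorem oriented_perm {K : PreAbstractSimplicialComplex V} {n : ℕ} (s : K.OrderedSimplex n)
    (ξ : Equiv.Perm (Fin n)) :
    oriented (s.perm ξ) = ((Equiv.Perm.sign ξ : ℤ) : ℝ) • oriented s := by
  unfold oriented
  rw [← map_smul, ← sub_eq_zero, ← map_sub, Submodule.mkQ_apply, Submodule.Quotient.mk_eq_zero]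
  refine Submodule.subset_span ⟨s, ξ, ?_⟩
  simp

/-- Removing `i` from the source and `ξ i` from the target of a permutation `ξ`. -/
theorem exists_perm_succAbove {n : ℕ} (ξ : Equiv.Perm (Fin (n + 1))) (i : Fin (n + 1)) :
    ∃ e : Equiv.Perm (Fin n), (∀ j, ξ (i.succAbove j) = (ξ i).succAbove (e j)) ∧
      (-1 : ℤ) ^ (i : ℕ) * (Equiv.Perm.sign e : ℤ) =
        (Equiv.Perm.sign ξ : ℤ) * (-1) ^ (ξ i : ℕ) := by
  obtain ⟨⟨p, e⟩, hpe⟩ := (Equiv.Perm.decomposeFin (n := n)).symm.surjective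
    ((ξ i).cycleRange * ξ * i.cycleRange.symm)
  have h0 : p = 0 := by
    have := congrArg (fun g : Equiv.Perm (Fin (n + 1)) => g 0) hpe
    simpa using this
  subst h0
  refine ⟨e, fun j => ?_, ?_⟩
  · have h := congrArg (fun g : Equiv.Perm (Fin (n + 1)) => g j.succ) hpe
    simp only [Equiv.Perm.decomposeFin_symm_apply_succ, Equiv.swap_self, Equiv.refl_apply,
      Equiv.Perm.mul_apply, Fin.cycleRange_symm_succ] at h
    have h2 := congrArg (ξ i).cycleRange.symm h
    simpa [Fin.cycleRange_symm_succ] using h2.symm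
  · have h := congrArg (fun g => ((Equiv.Perm.sign g : ℤˣ) : ℤ)) hpe
    simp only [Equiv.Perm.decomposeFin.symm_sign, Equiv.Perm.sign_mul, Fin.sign_cycleRange,
      Equiv.Perm.sign_symm, if_true, one_mul, Units.val_mul, Units.val_pow_eq_pow_val,
      Units.val_neg, Units.val_one] at h
    rw [h]
    have h1 : ((-1 : ℤ) ^ (i : ℕ)) * (-1) ^ (i : ℕ) = 1 := by
      rw [← mul_pow]; simp
    linear_combination ((Equiv.Perm.sign ξ : ℤ) * (-1) ^ (ξ i : ℕ)) * h1

/-- The alternating sum `∑ i, (-1)^i ⟨v₀, …, v_{i-1}, v_{i+1}, …, v_n⟩`, extended linearly to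
combinations of ordered simplices. -/
noncomputable def preBoundary (K : PreAbstractSimplicialComplex V) (n : ℕ) :
    (K.OrderedSimplex (n + 1) →₀ ℝ) →ₗ[ℝ] K.Chains n :=
  Finsupp.linearCombination ℝ fun s => ∑ i : Fin (n + 1), (-1 : ℝ) ^ (i : ℕ) • oriented (s.face i)

theorem orientationRel_le_ker_preBoundary (K : PreAbstractSimplicialComplex V) (n : ℕ) :
    K.orientationRel (n + 1) ≤ LinearMap.ker (K.preBoundary n) := by
  refine Submodule.span_le.mpr ?_
  rintro c ⟨s, ξ, rfl⟩
  simp only [SetLike.mem_coe, LinearMap.mem_ker, preBoundary, map_sub,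
    Finsupp.linearCombination_single, one_smul, sub_eq_zero]
  rw [Finset.smul_sum]
  conv_rhs => rw [← Equiv.sum_comp ξ]
  refine Finset.sum_congr rfl fun i _ => ?_
  obtain ⟨e, he, hs⟩ := exists_perm_succAbove ξ i
  have hf : (s.perm ξ).face i = (s.face (ξ i)).perm e := by
    apply Subtype.ext
    ext j
    simp [OrderedSimplex.face, OrderedSimplex.perm, he]
  rw [hf, oriented_perm, smul_smul, smul_smul]
  congr 1
  exact_mod_cast hs

/-- The boundary map `∂_n : C_n(K) → C_{n-1}(K)`; for `n = 0` it is the augmentation `⟨v⟩ ↦ 1`. -/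
noncomputable def boundary (K : PreAbstractSimplicialComplex V) (n : ℕ) :
    K.Chains (n + 1) →ₗ[ℝ] K.Chains n :=
  (K.orientationRel (n + 1)).liftQ (K.preBoundary n) (K.orientationRel_le_ker_preBoundary n)

theorem boundary_oriented {K : PreAbstractSimplicialComplex V} {n : ℕ}
    (s : K.OrderedSimplex (n + 1)) :
    K.boundary n (oriented s) = ∑ i : Fin (n + 1), (-1 : ℝ) ^ (i : ℕ) • oriented (s.face i) := by
  simp [boundary, oriented, preBoundary]

/-- The (reduced) `k`-th real homology `ker ∂_k / im ∂_{k+1}`. -/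
abbrev Homology (K : PreAbstractSimplicialComplex V) (k : ℕ) : Type _ :=
  LinearMap.ker (K.boundary k) ⧸
    (LinearMap.range (K.boundary (k + 1))).submoduleOf (LinearMap.ker (K.boundary k))

/-- The (reduced) `k`-th Betti number. -/
noncomputable def betti (K : PreAbstractSimplicialComplex V) (k : ℕ) : ℕ :=
  Module.finrank ℝ (K.Homology k)

/-- The link of `τ` in `K`; it may have no simplices at all. -/
def link [DecidableEq V] (K : PreAbstractSimplicialComplex V) (τ : Finset V) :
    PreAbstractSimplicialComplex V where
  faces := {σ | σ ∈ K.faces ∧ τ ∩ σ = ∅ ∧ τ ∪ σ ∈ K.faces}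
  isRelLowerSet_faces := by
    rintro σ ⟨hσ, hd, hu⟩
    refine ⟨(K.isRelLowerSet_faces hσ).1, fun ρ hρ hne => ⟨(K.isRelLowerSet_faces hσ).2 hρ hne,
      ?_, (K.isRelLowerSet_faces hu).2 (Finset.union_subset_union_right hρ)
        (hne.mono Finset.subset_union_right)⟩⟩
    exact Finset.subset_empty.mp ((Finset.inter_subset_inter_left hρ).trans hd.subset)

/-- The one-dimensional skeleton of `K`, as a graph whose vertices are those of `K`. -/
def oneSkeleton [DecidableEq V] (K : PreAbstractSimplicialComplex V) :
    SimpleGraph {v : V // {v} ∈ K.faces} where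
  Adj v w := v ≠ w ∧ ({v.1, w.1} : Finset V) ∈ K.faces
  symm := ⟨fun v w h => ⟨h.1.symm, by rw [Finset.pair_comm]; exact h.2⟩⟩
  loopless := ⟨fun _ h => h.1 rfl⟩

end PreAbstractSimplicialComplex

namespace SimpleGraph

variable {W : Type*}

open Classical in
/-- The averaging matrix: the transition matrix of the simple random walk, which stays put at
isolated vertices. -/
noncomputable def averagingMatrix [Fintype W] (G : SimpleGraph W) : Matrix W W ℝ :=
  Matrix.of fun v w =>
    if G.Adj v w then 1 / (G.degree v : ℝ)
    else if G.degree v = 0 ∧ v = w then 1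
    else 0

open Classical in
/-- The Laplacian `I - A` of the simple random walk. -/
noncomputable def randomWalkLaplacian [Fintype W] (G : SimpleGraph W) : Matrix W W ℝ :=
  1 - G.averagingMatrix

open Classical in
/-- `γ(G; a)`: the number of eigenvalues of the random walk Laplacian, counted with multiplicity,
that are at most `a`, minus one; it is `0` for the graph without vertices. -/
noncomputable def gamma [Finite W] (G : SimpleGraph W) (a : ℝ) : ℤ :=
  letI := Fintype.ofFinite W
  if IsEmpty W then 0
  else (G.randomWalkLaplacian.charpoly.roots.countP (· ≤ a) : ℤ) - 1

end SimpleGraph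

open Matrix in
theorem Matrix.IsHermitian.exists_linearMap_lt_dotProduct_mulVec {W : Type*} [Fintype W]
    [DecidableEq W] {S : Matrix W W ℝ} (hS : S.IsHermitian) {a : ℝ} (ha : 0 ≤ a) {y₀ : W → ℝ}
    (hy₀ : y₀ ≠ 0) (hSy₀ : S *ᵥ y₀ = 0) :
    ∃ m : ℕ, m + 1 = S.charpoly.roots.countP (· ≤ a) ∧ ∃ P : (W → ℝ) →ₗ[ℝ] (Fin m → ℝ),
      ∀ y, y₀ ⬝ᵥ y = 0 → P y = 0 → y ≠ 0 → a * (y ⬝ᵥ y) < y ⬝ᵥ S *ᵥ y := by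
  set u : W → W → ℝ := fun i => (hS.eigenvectorBasis i).ofLp with hu
  set l := hS.eigenvalues with hl
  have parseval (x y : W → ℝ) : x ⬝ᵥ y = ∑ i, (u i ⬝ᵥ x) * (u i ⬝ᵥ y) := by
    have h := hS.eigenvectorBasis.sum_inner_mul_inner (WithLp.toLp 2 x) (WithLp.toLp 2 y)
    simp only [EuclideanSpace.inner_eq_star_dotProduct, star_trivial] at h
    rw [dotProduct_comm, ← h]
    exact Finset.sum_congr rfl fun i _ => by rw [dotProduct_comm y]
  have hSu (i : W) (y : W → ℝ) : u i ⬝ᵥ S *ᵥ y = l i * (u i ⬝ᵥ y) := by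
    rw [dotProduct_mulVec, ← mulVec_transpose, ← conjTranspose_eq_transpose_of_trivial, hS.eq,
      hS.mulVec_eigenvectorBasis i, smul_dotProduct]
    simp [hu, hl]
  have hpos : ∃ i₀, u i₀ ⬝ᵥ y₀ ≠ 0 := by
    by_contra! h
    apply hy₀
    rw [← dotProduct_self_eq_zero, parseval]
    simp [h]
  obtain ⟨i₀, hi₀⟩ := hpos
  have hl0 (i : W) (hi : u i ⬝ᵥ y₀ ≠ 0) : l i = 0 := by
    have := hSu i y₀
    rw [hSy₀, dotProduct_zero] at this
    simpa [hi] using this.symm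
  let J := (Finset.univ.filter fun i => l i ≤ a).erase i₀
  have hcount : S.charpoly.roots.countP (· ≤ a) = (Finset.univ.filter fun i => l i ≤ a).card := by
    rw [hS.roots_charpoly_eq_eigenvalues, Multiset.countP_map]
    rfl
  refine ⟨J.card, ?_, LinearMap.pi fun j =>
    dotProductBilin ℝ ℝ (u (J.equivFin.symm j)), fun y hy hP hne => ?_⟩
  · rw [hcount, Finset.card_erase_add_one]
    simp [hl0 i₀ hi₀, ha]
  have hJ (i : W) (hi : i ∈ J) : u i ⬝ᵥ y = 0 := by
    have := congrFun hP (J.equivFin ⟨i, hi⟩)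
    simpa using this
  have hle (i : W) (hi : l i ≤ a) : u i ⬝ᵥ y = 0 := by
    by_cases h : i = i₀
    · subst h
      rw [parseval, Finset.sum_eq_single i] at hy
      · simpa [hi₀] using hy
      · intro j _ hj
        by_cases hj0 : u j ⬝ᵥ y₀ = 0
        · simp [hj0]
        · rw [hJ j (by simp [J, hj, hl0 j hj0, ha]), mul_zero]
      · simp
    · exact hJ i (by simp [J, h, hi])
  have hex : ∃ i, u i ⬝ᵥ y ≠ 0 := by
    by_contra! h
    apply hne
    rw [← dotProduct_self_eq_zero, parseval]
    simp [h]
  obtain ⟨i₁, hi₁⟩ := hex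
  rw [parseval, parseval, Finset.mul_sum]
  refine Finset.sum_lt_sum (fun i _ => ?_) ⟨i₁, Finset.mem_univ _, ?_⟩
  · rw [hSu]
    by_cases h : l i ≤ a
    · simp [hle i h]
    · nlinarith [mul_self_nonneg (u i ⬝ᵥ y)]
  · rw [hSu]
    have h : a < l i₁ := lt_of_not_ge fun h => hi₁ (hle i₁ h)
    nlinarith [mul_self_pos.2 hi₁]

namespace SimpleGraph

open Classical Matrix in
theorem exists_linearMap_gamma {W : Type*} [Fintype W] (G : SimpleGraph W) {a : ℝ} (ha : 0 ≤ a) :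
    ∃ m : ℕ, (m : ℤ) = G.gamma a ∧ ∃ P : (W → ℝ) →ₗ[ℝ] (Fin m → ℝ), ∀ x : W → ℝ,
      ∑ v, (max 1 (G.degree v) : ℕ) * x v = 0 → P x = 0 → x ≠ 0 →
      a * ∑ v, (max 1 (G.degree v) : ℕ) * x v ^ 2 <
        2⁻¹ * ∑ v, ∑ u, if G.Adj v u then (x v - x u) ^ 2 else 0 := by
  rcases isEmpty_or_nonempty W with hW | hW
  · exact ⟨0, by simp [gamma, hW], 0, fun x _ _ hx => (hx (Subsingleton.elim _ _)).elim⟩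
  set w : W → ℝ := fun v => ((max 1 (G.degree v) : ℕ) : ℝ) with hw
  have hwpos (v : W) : 0 < w v := by simp [hw]
  set r : W → ℝ := fun v => √(w v) with hr
  have hrpos (v : W) : 0 < r v := Real.sqrt_pos.2 (hwpos v)
  have hrr (v : W) : r v * r v = w v := Real.mul_self_sqrt (hwpos v).le
  let L := G.randomWalkLaplacian
  let M : Matrix W W ℝ := diagonal w * L
  have hM (v u : W) : M v u = (if v = u then (G.degree v : ℝ) else 0) -
      if G.Adj v u then 1 else 0 := by
    simp only [M, L, diagonal_mul, randomWalkLaplacian, averagingMatrix, Matrix.sub_apply, one_apply,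
      of_apply, hw]
    by_cases hadj : G.Adj v u
    · have hd : 0 < G.degree v := (G.degree_pos_iff_exists_adj v).2 ⟨u, hadj⟩
      have : max 1 (G.degree v) = G.degree v := by omega
      rw [this]
      have : (G.degree v : ℝ) ≠ 0 := by positivity
      simp [hadj, hadj.ne, this]
    · by_cases hvu : v = u
      · subst hvu
        by_cases hd : G.degree v = 0
        · simp [hd]
        · have : max 1 (G.degree v) = G.degree v := by omega
          simp [hd, this]
      · simp [hadj, hvu]
  let R : (Matrix W W ℝ)ˣ := ⟨diagonal r, diagonal fun v => (r v)⁻¹,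
    by simp [diagonal_mul_diagonal, (hrpos _).ne'],
    by simp [diagonal_mul_diagonal, (hrpos _).ne']⟩
  let S : Matrix W W ℝ := R.val * L * R⁻¹.val
  have hSM (v u : W) : S v u = (r v)⁻¹ * M v u * (r u)⁻¹ := by
    have : S v u = r v * L v u * (r u)⁻¹ := by
      simp only [S, R, Units.inv_mk]
      rw [mul_diagonal, diagonal_mul]
    have h2 : M v u = w v * L v u := by simp [M]
    rw [this, h2, ← hrr]
    have := (hrpos v).ne'
    field_simp
  have hMsymm (v u : W) : M v u = M u v := by
    rw [hM, hM]
    by_cases h : v = u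
    · subst h; rfl
    · simp [h, Ne.symm h, G.adj_comm]
  have hS : S.IsHermitian := by
    ext v u
    simp only [conjTranspose_apply, star_trivial]
    rw [hSM, hSM, hMsymm]
    ring
  have hquad (x z : W → ℝ) : (fun v => r v * x v) ⬝ᵥ S *ᵥ (fun v => r v * z v) =
      ∑ v, ∑ u, x v * M v u * z u := by
    simp only [dotProduct, mulVec, Finset.mul_sum]
    refine Finset.sum_congr rfl fun v _ => Finset.sum_congr rfl fun u _ => ?_
    rw [hSM]
    have := (hrpos v).ne'
    have := (hrpos u).ne'
    field_simp
  have hdeg (v : W) : (G.degree v : ℝ) = ∑ u, if G.Adj v u then (1 : ℝ) else 0 := by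
    rw [Finset.sum_boole, ← card_neighborFinset_eq_degree, neighborFinset_eq_filter]
  have hMz (v : W) (z : W → ℝ) : ∑ u, M v u * z u =
      ∑ u, if G.Adj v u then z v - z u else 0 := by
    simp only [hM, sub_mul, ite_mul, zero_mul, one_mul, Finset.sum_sub_distrib,
      Finset.sum_ite_eq, Finset.mem_univ, if_true]
    rw [hdeg, Finset.sum_mul, ← Finset.sum_sub_distrib]
    refine Finset.sum_congr rfl fun u _ => ?_
    split_ifs <;> simp
  have hr0 : r ≠ 0 := fun h => (hrpos (Classical.arbitrary W)).ne' (congrFun h _)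
  have hSr : S *ᵥ r = 0 := by
    ext v
    simp only [mulVec, dotProduct, hSM, Pi.zero_apply]
    have : ∀ u, (r v)⁻¹ * M v u * (r u)⁻¹ * r u = (r v)⁻¹ * (M v u * 1) := fun u => by
      have := (hrpos u).ne'
      field_simp
    simp only [this]
    rw [← Finset.mul_sum, hMz v (fun _ => 1)]
    simp
  obtain ⟨m, hm, P, hP⟩ := hS.exists_linearMap_lt_dotProduct_mulVec ha hr0 hSr
  refine ⟨m, ?_, P ∘ₗ LinearMap.pi fun v => r v • LinearMap.proj v, fun x hx hPx hne => ?_⟩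
  · have hF : Fintype.ofFinite W = ‹Fintype W› := Subsingleton.elim _ _
    rw [gamma, if_neg (not_isEmpty_of_nonempty W), hF]
    have : S.charpoly = G.randomWalkLaplacian.charpoly := by
      simpa only [S, L, coe_units_inv] using charpoly_units_conj R L
    rw [← this, eq_sub_iff_add_eq]
    exact_mod_cast hm
  · have h := hP (fun v => r v * x v) ?_ hPx ?_
    · rw [hquad] at h
      have e1 : (fun v => r v * x v) ⬝ᵥ (fun v => r v * x v) = ∑ v, w v * x v ^ 2 := by
        simp only [dotProduct]
        refine Finset.sum_congr rfl fun v _ => ?_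
        rw [← hrr]; ring
      have e2 : ∑ v, ∑ u, x v * M v u * x u =
          2⁻¹ * ∑ v, ∑ u, if G.Adj v u then (x v - x u) ^ 2 else 0 := by
        have e3 : ∑ v, ∑ u, x v * M v u * x u =
            ∑ v, ∑ u, if G.Adj v u then x v * (x v - x u) else 0 := by
          refine Finset.sum_congr rfl fun v _ => ?_
          simp only [mul_assoc]
          rw [← Finset.mul_sum, hMz, Finset.mul_sum]
          simp
        have e4 : ∑ v, ∑ u, (if G.Adj v u then x v * (x v - x u) else 0) =
            ∑ v, ∑ u, if G.Adj v u then x u * (x u - x v) else 0 := by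
          rw [Finset.sum_comm]
          simp only [G.adj_comm]
        have e5 : ∑ v, ∑ u, (if G.Adj v u then (x v - x u) ^ 2 else 0) =
            ∑ v, ∑ u, (if G.Adj v u then x v * (x v - x u) else 0) +
            ∑ v, ∑ u, (if G.Adj v u then x u * (x u - x v) else 0) := by
          simp only [← Finset.sum_add_distrib]
          refine Finset.sum_congr rfl fun v _ => Finset.sum_congr rfl fun u _ => ?_
          split_ifs <;> ring
        rw [e5, ← e4, e3]; ring
      rwa [e1, e2] at h
    · rw [← hx]
      simp only [dotProduct]
      refine Finset.sum_congr rfl fun v _ => ?_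
      rw [← mul_assoc, hrr]
    · intro h0
      apply hne
      ext v
      have := congrFun h0 v
      simpa [(hrpos v).ne'] using this

end SimpleGraph

theorem LinearMap.finrank_ker_quotient_range_le {C₀ C₁ C₂ ι : Type*} [AddCommGroup C₀]
    [AddCommGroup C₁] [AddCommGroup C₂] [Module ℝ C₀] [Module ℝ C₁] [Module ℝ C₂]
    [FiniteDimensional ℝ C₀] [FiniteDimensional ℝ C₁] [FiniteDimensional ℝ C₂] [Fintype ι]
    (f : C₁ →ₗ[ℝ] C₀) (g : C₂ →ₗ[ℝ] C₁) (hfg : f ∘ₗ g = 0)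
    (Φ : Module.Dual ℝ C₁ →ₗ[ℝ] (ι → ℝ))
    (b : Module.Dual ℝ C₁ →ₗ[ℝ] Module.Dual ℝ C₁ →ₗ[ℝ] ℝ)
    (hinj : ∀ φ : Module.Dual ℝ C₁, φ ∘ₗ g = 0 → Φ φ = 0 →
      (∀ ψ : Module.Dual ℝ C₀, b φ (ψ ∘ₗ f) = 0) → φ = 0) :
    Module.finrank ℝ (ker f ⧸ (range g).submoduleOf (ker f)) ≤ Fintype.card ι := by
  have hle : range g ≤ ker f := range_le_ker_iff.2 hfg
  have h1 := ((range g).submoduleOf (ker f)).finrank_quotient_add_finrank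
  rw [(Submodule.submoduleOfEquivOfLe hle).finrank_eq] at h1
  have h2 := f.finrank_range_add_finrank_ker
  let T : Module.Dual ℝ C₁ →ₗ[ℝ]
      (Module.Dual ℝ (range g) × (ι → ℝ)) × Module.Dual ℝ (Module.Dual ℝ (range f)) :=
    ((range g).subtype.dualMap.prod Φ).prod (f.rangeRestrict.dualMap.dualMap ∘ₗ b)
  have hT : Function.Injective T := by
    refine (injective_iff_map_eq_zero T).2 fun φ hφ => ?_
    obtain ⟨hφ12, hφ3⟩ := Prod.mk.inj hφ
    obtain ⟨hφ1, hφ2⟩ := Prod.mk.inj hφ12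
    refine hinj φ (LinearMap.ext fun c => ?_) hφ2 fun ψ => ?_
    · exact LinearMap.congr_fun (f := (range g).subtype.dualMap φ) hφ1 (g.rangeRestrict c)
    · exact LinearMap.congr_fun (f := (f.rangeRestrict.dualMap.dualMap ∘ₗ b) φ) hφ3
        ((range f).subtype.dualMap ψ)
  have h3 := LinearMap.finrank_le_finrank_of_injective hT
  rw [Module.finrank_prod, Module.finrank_prod] at h3
  simp only [Subspace.dual_finrank_eq, Module.finrank_fintype_fun_eq_card] at h3
  omega

namespace PreAbstractSimplicialComplex

variable {V : Type*} {K : PreAbstractSimplicialComplex V} {n : ℕ}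

theorem isSimplex_iff_of_nonempty {σ : Finset V} (h : σ.Nonempty) :
    K.IsSimplex σ ↔ σ ∈ K.faces := by
  simp [IsSimplex, h.ne_empty]

theorem singleton_mem_link_iff [DecidableEq V] {τ : Finset V} {v : V} :
    {v} ∈ (K.link τ).faces ↔ v ∉ τ ∧ insert v τ ∈ K.faces := by
  change {v} ∈ K.faces ∧ τ ∩ {v} = ∅ ∧ τ ∪ {v} ∈ K.faces ↔ _
  rw [← Finset.disjoint_iff_inter_eq_empty, Finset.disjoint_singleton_right, Finset.union_comm,
    ← Finset.insert_eq]
  refine ⟨fun h => h.2, fun h => ⟨(K.isRelLowerSet_faces h.2).2 ?_ (by simp), h⟩⟩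
  exact Finset.singleton_subset_iff.2 (Finset.mem_insert_self _ _)

theorem oneSkeleton_link_adj_iff [DecidableEq V] {τ : Finset V}
    (v u : {v : V // {v} ∈ (K.link τ).faces}) :
    (K.link τ).oneSkeleton.Adj v u ↔ {u.1} ∈ (K.link (insert v.1 τ)).faces := by
  obtain ⟨v, hv⟩ := v
  obtain ⟨u, hu⟩ := u
  rw [singleton_mem_link_iff]
  have hv' := singleton_mem_link_iff.1 hv
  have hu' := singleton_mem_link_iff.1 hu
  change (⟨v, hv⟩ : {v : V // {v} ∈ (K.link τ).faces}) ≠ ⟨u, hu⟩ ∧ ({v, u} ∈ K.faces ∧ τ ∩ {v, u} = ∅ ∧ τ ∪ {v, u} ∈ K.faces) ↔ _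
  have e : τ ∪ {v, u} = insert u (insert v τ) := by
    ext; simp; tauto
  rw [e, ← Finset.disjoint_iff_inter_eq_empty]
  refine ⟨fun h => ⟨?_, h.2.2.2⟩, fun h => ?_⟩
  · simpa [hu'.1, eq_comm] using h.1
  · have h1 := h.1
    simp only [Finset.mem_insert, not_or] at h1
    refine ⟨by simpa [eq_comm] using h1.1, (K.isRelLowerSet_faces h.2).2 ?_ (by simp), ?_, h.2⟩
    · intro x; simp; tauto
    · simp [hv'.1, hu'.1]

namespace OrderedSimplex

instance [Finite V] : Finite (K.OrderedSimplex n) :=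
  inferInstanceAs (Finite {s : Fin n ↪ V // K.IsSimplex (Finset.univ.map s)})

noncomputable instance [Finite V] : Fintype (K.OrderedSimplex n) := Fintype.ofFinite _

/-- The vertex set of an ordered simplex. -/
def support (s : K.OrderedSimplex n) : Finset V := Finset.univ.map s.1

theorem mem_support {s : K.OrderedSimplex n} {v : V} : v ∈ s.support ↔ ∃ i, s.1 i = v := by
  simp [support]

@[simp] theorem support_perm (s : K.OrderedSimplex n) (ξ : Equiv.Perm (Fin n)) :
    (s.perm ξ).support = s.support := by
  ext v
  simp only [mem_support]
  exact ⟨fun ⟨i, h⟩ => ⟨ξ i, h⟩, fun ⟨i, h⟩ => ⟨ξ.symm i, by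
    change s.1 (ξ (ξ.symm i)) = v; simpa using h⟩⟩

theorem exists_perm_eq {s t : K.OrderedSimplex n} (h : s.support = t.support) :
    ∃ ξ, s.perm ξ = t := by
  have h1 (i : Fin n) : ∃ j, s.1 j = t.1 i :=
    mem_support.1 (h ▸ mem_support.2 ⟨i, rfl⟩)
  choose ξ hξ using h1
  have hinj : Function.Injective ξ := fun i j hij =>
    t.1.injective (by rw [← hξ, ← hξ, hij])
  refine ⟨Equiv.ofBijective ξ (Finite.injective_iff_bijective.1 hinj), Subtype.ext ?_⟩
  ext i
  exact hξ i

/-- Reordering by a fixed permutation, as a permutation of the ordered simplices. -/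
def permEquiv (ξ : Equiv.Perm (Fin n)) : K.OrderedSimplex n ≃ K.OrderedSimplex n where
  toFun s := s.perm ξ
  invFun s := s.perm ξ⁻¹
  left_inv s := Subtype.ext (by ext i; simp [perm])
  right_inv s := Subtype.ext (by ext i; simp [perm])

theorem exists_face_perm (s : K.OrderedSimplex (n + 1)) (ξ : Equiv.Perm (Fin (n + 1)))
    (i : Fin (n + 1)) : ∃ e : Equiv.Perm (Fin n), (s.perm ξ).face i = (s.face (ξ i)).perm e ∧
      (-1 : ℤ) ^ (i : ℕ) * (Equiv.Perm.sign e : ℤ) =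
        (Equiv.Perm.sign ξ : ℤ) * (-1) ^ (ξ i : ℕ) := by
  obtain ⟨e, he, hs⟩ := exists_perm_succAbove ξ i
  refine ⟨e, Subtype.ext ?_, hs⟩
  ext j
  simp [face, perm, he]

theorem face_face (s : K.OrderedSimplex (n + 2)) (i : Fin (n + 2)) (j : Fin (n + 1)) :
    (s.face (i.succAbove j)).face (j.predAbove i) = (s.face i).face j := by
  apply Subtype.ext
  ext k
  exact congrArg s.1 (Fin.succAbove_succAbove_succAbove_predAbove i j k)

@[simp] theorem face_apply (s : K.OrderedSimplex (n + 1)) (i : Fin (n + 1)) (j : Fin n) :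
    (s.face i).1 j = s.1 (i.succAbove j) := rfl

@[simp] theorem perm_apply (s : K.OrderedSimplex n) (ξ : Equiv.Perm (Fin n)) (j : Fin n) :
    (s.perm ξ).1 j = s.1 (ξ j) := rfl

section Cons

variable [DecidableEq V]

/-- The ordered simplex `(v, v₀, …, v_{n-1})`. -/
def cons (t : K.OrderedSimplex n) (v : {v : V // {v} ∈ (K.link t.support).faces}) :
    K.OrderedSimplex (n + 1) :=
  ⟨Fin.Embedding.cons t.1 (a := v.1) (by
    have := (singleton_mem_link_iff.1 v.2).1
    rwa [mem_support] at this), by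
    refine Or.inr ?_
    convert (singleton_mem_link_iff.1 v.2).2
    ext x
    simp only [Finset.mem_map, Finset.mem_univ, true_and, Finset.mem_insert, Fin.exists_fin_succ]
    exact or_congr eq_comm mem_support.symm⟩

@[simp] theorem cons_apply_zero (t : K.OrderedSimplex n)
    (v : {v : V // {v} ∈ (K.link t.support).faces}) : (t.cons v).1 0 = v.1 := rfl

@[simp] theorem cons_apply_succ (t : K.OrderedSimplex n)
    (v : {v : V // {v} ∈ (K.link t.support).faces}) (i : Fin n) :
    (t.cons v).1 i.succ = t.1 i := rfl

attribute [irreducible] cons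

theorem support_cons (t : K.OrderedSimplex n)
    (v : {v : V // {v} ∈ (K.link t.support).faces}) :
    (t.cons v).support = insert v.1 t.support := by
  ext x
  rw [Finset.mem_insert, mem_support, mem_support, Fin.exists_fin_succ]
  simp [eq_comm]

@[simp] theorem face_zero_cons (t : K.OrderedSimplex n)
    (v : {v : V // {v} ∈ (K.link t.support).faces}) : (t.cons v).face 0 = t := by
  apply Subtype.ext
  ext i
  simp

theorem apply_zero_mem_link (s : K.OrderedSimplex (n + 1)) :
    {s.1 0} ∈ (K.link (s.face 0).support).faces := by
  rw [singleton_mem_link_iff, mem_support]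
  refine ⟨fun ⟨i, hi⟩ => ?_, ?_⟩
  · rw [face_apply] at hi
    exact Fin.succAbove_ne _ _ (s.1.injective hi)
  · have h : insert (s.1 0) (s.face 0).support = s.support := by
      ext x
      rw [Finset.mem_insert, mem_support, mem_support, Fin.exists_fin_succ]
      simp [eq_comm]
    rw [h, ← isSimplex_iff_of_nonempty ⟨s.1 0, mem_support.2 ⟨0, rfl⟩⟩]
    exact s.2

/-- An ordered simplex is a first vertex followed by an ordered simplex. -/
def consEquiv : (Σ t : K.OrderedSimplex n, {v : V // {v} ∈ (K.link t.support).faces}) ≃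
    K.OrderedSimplex (n + 1) where
  toFun p := p.1.cons p.2
  invFun s := ⟨s.face 0, s.1 0, s.apply_zero_mem_link⟩
  left_inv p := by
    obtain ⟨t, v⟩ := p
    have h : ∀ (t' : K.OrderedSimplex n) (_ : t' = t) (x : V) (_ : x = v.1) (hx),
        (⟨t', x, hx⟩ : Σ t : K.OrderedSimplex n, {v : V // {v} ∈ (K.link t.support).faces}) =
          ⟨t, v⟩ := by
      rintro _ rfl _ rfl _; rfl
    exact h _ (face_zero_cons t v) _ (cons_apply_zero t v) _
  right_inv s := by
    apply Subtype.ext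
    ext i
    refine Fin.cases (cons_apply_zero _ _) (fun j => ?_) i
    simp

open Classical in
theorem sum_cons [Fintype V] {M : Type*} [AddCommMonoid M] (h : K.OrderedSimplex (n + 1) → M) :
    ∑ t : K.OrderedSimplex n, ∑ v : {v : V // {v} ∈ (K.link t.support).faces}, h (t.cons v) =
      ∑ s, h s := by
  rw [← Equiv.sum_comp (consEquiv (K := K) (n := n)), Fintype.sum_sigma]
  rfl

theorem cons_perm (t : K.OrderedSimplex n) (ξ : Equiv.Perm (Fin n)) (v : V)
    (hv : {v} ∈ (K.link t.support).faces) (hv' : {v} ∈ (K.link (t.perm ξ).support).faces) :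
    (t.perm ξ).cons ⟨v, hv'⟩ =
      (t.cons ⟨v, hv⟩).perm (Equiv.Perm.decomposeFin.symm (0, ξ)) := by
  apply Subtype.ext
  ext i
  refine Fin.cases ?_ (fun j => ?_) i <;> simp

theorem face_one_cons_cons (t : K.OrderedSimplex n)
    (v : {v : V // {v} ∈ (K.link t.support).faces})
    (u : {u : V // {u} ∈ (K.link (t.cons v).support).faces})
    (hu : {u.1} ∈ (K.link t.support).faces) :
    ((t.cons v).cons u).face 1 = t.cons ⟨u.1, hu⟩ := by
  apply Subtype.ext
  ext i
  refine Fin.cases ?_ (fun j => ?_) i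
  · rw [face_apply, cons_apply_zero, Fin.succAbove_of_castSucc_lt _ _ (by simp), Fin.castSucc_zero,
      cons_apply_zero]
  · rw [face_apply, cons_apply_succ, Fin.succAbove_of_le_castSucc _ _ (by simp [Fin.le_def]),
      cons_apply_succ, cons_apply_succ]

theorem mem_link_of_mem_link_cons (t : K.OrderedSimplex n)
    (v : {v : V // {v} ∈ (K.link t.support).faces}) {u : V}
    (hu : {u} ∈ (K.link (t.cons v).support).faces) : {u} ∈ (K.link t.support).faces := by
  rw [support_cons] at hu
  rw [singleton_mem_link_iff] at *
  refine ⟨fun h => hu.1 (Finset.mem_insert_of_mem h), (K.isRelLowerSet_faces hu.2).2 ?_ (by simp)⟩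
  exact Finset.insert_subset_insert _ (Finset.subset_insert _ _)

open Classical in
theorem sum_adj [Fintype V] {M : Type*} [AddCommMonoid M] (t : K.OrderedSimplex n)
    (v : {v : V // {v} ∈ (K.link t.support).faces}) (F : V → M) :
    (∑ u, if (K.link t.support).oneSkeleton.Adj v u then F u.1 else 0) =
      ∑ u : {u : V // {u} ∈ (K.link (t.cons v).support).faces}, F u.1 := by
  simp only [oneSkeleton_link_adj_iff, ← support_cons]
  have h (p : V → Prop) (F : V → M) : ∑ u : {u : V // p u}, F u.1 = ∑ u, if p u then F u else 0 := by
    rw [← Finset.sum_filter]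
    exact (Finset.sum_subtype _ (by simp) F).symm
  rw [h (fun u => {u} ∈ (K.link t.support).faces)
    (fun u => if {u} ∈ (K.link (t.cons v).support).faces then F u else 0), h]
  refine Finset.sum_congr rfl fun u _ => ?_
  by_cases hu : {u} ∈ (K.link (t.cons v).support).faces
  · simp [hu, mem_link_of_mem_link_cons t v hu]
  · simp [hu]

open Classical in
theorem degree_link [Fintype V] (t : K.OrderedSimplex n)
    (v : {v : V // {v} ∈ (K.link t.support).faces}) :
    (K.link t.support).oneSkeleton.degree v =
      Fintype.card {u : V // {u} ∈ (K.link (t.cons v).support).faces} := by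
  have := t.sum_adj v (fun _ => 1)
  rw [← SimpleGraph.card_neighborFinset_eq_degree, SimpleGraph.neighborFinset_eq_filter]
  simpa using this

end Cons

end OrderedSimplex

open OrderedSimplex

theorem boundary_comp_boundary (K : PreAbstractSimplicialComplex V) (n : ℕ) :
    K.boundary n ∘ₗ K.boundary (n + 1) = 0 := by
  refine Submodule.linearMap_qext _ (Finsupp.lhom_ext' fun s => LinearMap.ext_ring ?_)
  change K.boundary n (K.boundary (n + 1) (oriented s)) = 0
  simp only [boundary_oriented, map_sum, map_smul, Finset.smul_sum, smul_smul]
  rw [← Fintype.sum_prod_type' (f := fun (i : Fin (n + 2)) (j : Fin (n + 1)) =>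
    ((-1 : ℝ) ^ (i : ℕ) * (-1) ^ (j : ℕ)) • oriented ((s.face i).face j))]
  refine Finset.sum_ninvolution (fun p => (p.1.succAbove p.2, p.2.predAbove p.1))
    (fun p => ?_) (fun p _ => ?_) (fun _ => Finset.mem_univ _) (fun p => ?_)
  · dsimp only
    rw [face_face, ← add_smul, ← pow_add, ← pow_add, Fin.neg_one_pow_succAbove_add_predAbove,
      add_neg_cancel, zero_smul]
  · exact fun h => Fin.succAbove_ne _ _ (congrArg Prod.fst h)
  · ext1
    · exact Fin.succAbove_succAbove_predAbove _ _
    · exact Fin.predAbove_predAbove_succAbove _ _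

theorem dual_ext {φ ψ : Module.Dual ℝ (K.Chains n)}
    (h : ∀ s : K.OrderedSimplex n, φ (oriented s) = ψ (oriented s)) : φ = ψ :=
  Submodule.linearMap_qext _ (Finsupp.lhom_ext' fun s => LinearMap.ext_ring (h s))

/-- A function on ordered simplices is alternating if it extends to oriented chains. -/
def IsAlternating (f : K.OrderedSimplex n → ℝ) : Prop :=
  ∀ s ξ, f (s.perm ξ) = ((Equiv.Perm.sign ξ : ℤ) : ℝ) * f s

theorem isAlternating_dual (φ : Module.Dual ℝ (K.Chains n)) :
    IsAlternating fun s : K.OrderedSimplex n => φ (oriented s) := fun s ξ => by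
  simp [oriented_perm]

theorem IsAlternating.exists_dual {f : K.OrderedSimplex n → ℝ} (hf : IsAlternating f) :
    ∃ φ : Module.Dual ℝ (K.Chains n), ∀ s, φ (oriented s) = f s := by
  refine ⟨(K.orientationRel n).liftQ (Finsupp.linearCombination ℝ f) ?_, fun s => ?_⟩
  · refine Submodule.span_le.mpr ?_
    rintro c ⟨s, ξ, rfl⟩
    simp [hf s ξ]
  · change Finsupp.linearCombination ℝ f (Finsupp.single s 1) = f s
    simp

/-- The term of the coboundary of `f` coming from the `i`-th face. -/
def faceTerm (f : K.OrderedSimplex n → ℝ) (i : Fin (n + 1)) (s : K.OrderedSimplex (n + 1)) : ℝ :=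
  (-1) ^ (i : ℕ) * f (s.face i)

theorem IsAlternating.faceTerm_perm {f : K.OrderedSimplex n → ℝ} (hf : IsAlternating f)
    (i : Fin (n + 1)) (s : K.OrderedSimplex (n + 1)) (ξ : Equiv.Perm (Fin (n + 1))) :
    faceTerm f i (s.perm ξ) = ((Equiv.Perm.sign ξ : ℤ) : ℝ) * faceTerm f (ξ i) s := by
  obtain ⟨e, he, hs⟩ := exists_face_perm s ξ i
  have hs' : (-1 : ℝ) ^ (i : ℕ) * ((Equiv.Perm.sign e : ℤ) : ℝ) =
      ((Equiv.Perm.sign ξ : ℤ) : ℝ) * (-1) ^ (ξ i : ℕ) := by exact_mod_cast hs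
  rw [faceTerm, faceTerm, he, hf, ← mul_assoc, ← mul_assoc, hs']

theorem sign_mul_sign (ξ : Equiv.Perm (Fin n)) :
    ((Equiv.Perm.sign ξ : ℤ) : ℝ) * ((Equiv.Perm.sign ξ : ℤ) : ℝ) = 1 := by
  norm_cast
  simp

theorem dual_boundary_oriented (φ : Module.Dual ℝ (K.Chains n)) (s : K.OrderedSimplex (n + 1)) :
    (φ ∘ₗ K.boundary n) (oriented s) = ∑ i, faceTerm (fun t => φ (oriented t)) i s := by
  simp [boundary_oriented, faceTerm]

theorem IsAlternating.sum_mul_faceTerm [Finite V] {f : K.OrderedSimplex n → ℝ}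
    (hf : IsAlternating f) {h : K.OrderedSimplex (n + 1) → ℝ} (hh : IsAlternating h)
    (i : Fin (n + 1)) : ∑ s, h s * faceTerm f i s = ∑ s, h s * faceTerm f 0 s := by
  rw [← Equiv.sum_comp (permEquiv (Equiv.swap 0 i)) fun s => h s * faceTerm f 0 s]
  refine Finset.sum_congr rfl fun s _ => ?_
  change _ = h (s.perm _) * faceTerm f 0 (s.perm _)
  rw [hh, hf.faceTerm_perm, Equiv.swap_apply_left]
  linear_combination (-h s * faceTerm f i s) * sign_mul_sign (Equiv.swap 0 i)

open Classical in
theorem IsAlternating.sum_mul_coboundary [Fintype V] [DecidableEq V] {f : K.OrderedSimplex n → ℝ}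
    (hf : IsAlternating f) {h : K.OrderedSimplex (n + 1) → ℝ} (hh : IsAlternating h) :
    ∑ s, h s * ∑ i, faceTerm f i s = (n + 1) * ∑ t : K.OrderedSimplex n,
      (∑ v : {v : V // {v} ∈ (K.link t.support).faces}, h (t.cons v)) * f t := by
  simp only [Finset.mul_sum]
  rw [Finset.sum_comm]
  simp only [hf.sum_mul_faceTerm hh]
  rw [Finset.sum_const, ← sum_cons]
  simp [faceTerm, Finset.sum_mul, Finset.mul_sum]

open Classical in
theorem IsAlternating.sum_cons [Fintype V] [DecidableEq V] {h : K.OrderedSimplex (n + 1) → ℝ}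
    (hh : IsAlternating h) : IsAlternating fun t : K.OrderedSimplex n =>
      ∑ v : {v : V // {v} ∈ (K.link t.support).faces}, h (t.cons v) := by
  intro t ξ
  dsimp only
  rw [Finset.mul_sum]
  refine Fintype.sum_equiv (Equiv.subtypeEquivRight fun v => by rw [support_perm]) _ _ fun v => ?_
  rw [cons_perm t ξ v.1 (by simpa using v.2) v.2, hh]
  simp
  rfl

theorem IsAlternating.sum_faceTerm_sq [Finite V] {f : K.OrderedSimplex (n + 1) → ℝ}
    (hf : IsAlternating f) (hcl : ∀ e, ∑ i, faceTerm f i e = 0) :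
    (n + 1) * ∑ e, (faceTerm f 0 e + faceTerm f 1 e) ^ 2 = 2 * n * ∑ e, faceTerm f 0 e ^ 2 := by
  have hcross (j : Fin (n + 1)) : ∑ e, faceTerm f 0 e * faceTerm f j.succ e =
      ∑ e, faceTerm f 0 e * faceTerm f 1 e := by
    rw [← Equiv.sum_comp (permEquiv (Equiv.swap 1 j.succ))
      fun e => faceTerm f 0 e * faceTerm f 1 e]
    refine Finset.sum_congr rfl fun e _ => ?_
    change _ = faceTerm f 0 (e.perm _) * faceTerm f 1 (e.perm _)
    rw [hf.faceTerm_perm, hf.faceTerm_perm, Equiv.swap_apply_left,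
      Equiv.swap_apply_of_ne_of_ne (by simp) (Fin.succ_ne_zero j).symm]
    linear_combination (-faceTerm f 0 e * faceTerm f j.succ e) *
      sign_mul_sign (Equiv.swap 1 j.succ)
  have hsq : ∑ e, faceTerm f 1 e ^ 2 = ∑ e, faceTerm f 0 e ^ 2 := by
    rw [← Equiv.sum_comp (permEquiv (Equiv.swap 0 1)) fun e => faceTerm f 0 e ^ 2]
    refine Finset.sum_congr rfl fun e _ => ?_
    change _ = faceTerm f 0 (e.perm _) ^ 2
    rw [hf.faceTerm_perm, Equiv.swap_apply_left]
    linear_combination (-faceTerm f 1 e ^ 2) * sign_mul_sign (n := n + 2) (Equiv.swap 0 1)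
  have hsum : ∑ e, faceTerm f 0 e ^ 2 + (n + 1) * ∑ e, faceTerm f 0 e * faceTerm f 1 e = 0 := by
    have h : ∑ e, faceTerm f 0 e * ∑ i, faceTerm f i e = 0 := by simp [hcl]
    simp only [Finset.mul_sum] at h
    rw [Finset.sum_comm, Fin.sum_univ_succ] at h
    simp only [hcross, ← pow_two] at h
    simpa using h
  have hexp : ∑ e, (faceTerm f 0 e + faceTerm f 1 e) ^ 2 = ∑ e, faceTerm f 0 e ^ 2 +
      2 * ∑ e, faceTerm f 0 e * faceTerm f 1 e + ∑ e, faceTerm f 1 e ^ 2 := by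
    rw [Finset.mul_sum, ← Finset.sum_add_distrib, ← Finset.sum_add_distrib]
    exact Finset.sum_congr rfl fun e _ => by ring
  rw [hexp, hsq]
  linear_combination 2 * hsum

end PreAbstractSimplicialComplex

namespace PreAbstractSimplicialComplex

open OrderedSimplex

variable {V : Type*} {K : PreAbstractSimplicialComplex V} {n : ℕ}

theorem exists_support_eq [Fintype V] {τ : Finset V} {k : ℤ} (hτ : τ ∈ K.simplices k)
    (hk : k = (n : ℤ) - 1) : ∃ t : K.OrderedSimplex n, t.support = τ := by
  classical
  simp only [simplices, Finset.mem_filter, Finset.mem_univ, true_and] at hτ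
  have hc : τ.card = n := by omega
  let e := (τ.equivFinOfCardEq hc).symm
  have he : Finset.univ.map (e.toEmbedding.trans (Function.Embedding.subtype _)) = τ := by
    ext v
    simp only [Finset.mem_map, Finset.mem_univ, true_and]
    exact ⟨fun ⟨i, hi⟩ => hi ▸ (e i).2, fun h => ⟨e.symm ⟨v, h⟩, by simp⟩⟩
  exact ⟨⟨_, (congrArg K.IsSimplex he).mpr hτ.1⟩, he⟩

theorem support_mem_simplices [Fintype V] (t : K.OrderedSimplex n) :
    t.support ∈ K.simplices ((n : ℤ) - 1) := by
  simp only [simplices, Finset.mem_filter, Finset.mem_univ, true_and]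
  exact ⟨t.2, by simp [OrderedSimplex.support]⟩

variable [DecidableEq V]

open Classical in
/-- The oriented simplex `⟨v, v₀, …, v_{n-1}⟩`, or zero if this is not a simplex. -/
noncomputable def coneChain (t : K.OrderedSimplex n) (v : V) : K.Chains (n + 1) :=
  if h : {v} ∈ (K.link t.support).faces then oriented (t.cons ⟨v, h⟩) else 0

theorem coneChain_coe (t : K.OrderedSimplex n)
    (v : {v : V // {v} ∈ (K.link t.support).faces}) : coneChain t v.1 = oriented (t.cons v) :=
  dif_pos v.2

theorem coneChain_perm (t : K.OrderedSimplex n) (ξ : Equiv.Perm (Fin n)) (v : V) :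
    coneChain (t.perm ξ) v = ((Equiv.Perm.sign ξ : ℤ) : ℝ) • coneChain t v := by
  by_cases h : {v} ∈ (K.link t.support).faces
  · have h' : {v} ∈ (K.link (t.perm ξ).support).faces := by simpa using h
    rw [coneChain, dif_pos h', cons_perm t ξ v h h', oriented_perm, coneChain, dif_pos h]
    simp
  · have h' : {v} ∉ (K.link (t.perm ξ).support).faces := by simpa using h
    rw [coneChain, dif_neg h', coneChain, dif_neg h, smul_zero]

theorem exists_cons_eq (s : K.OrderedSimplex (n + 1)) : ∃ t : K.OrderedSimplex n, ∃ v, t.cons v = s :=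
  let ⟨⟨t, v⟩, h⟩ := consEquiv.surjective s
  ⟨t, v, h⟩

section Local

variable [Fintype V]

open Classical in
/-- The number of simplices with one more vertex that contain `s`, or one if there are none. -/
noncomputable def weight (s : K.OrderedSimplex n) : ℕ :=
  max 1 (Fintype.card {u : V // {u} ∈ (K.link s.support).faces})

open Classical in
theorem weight_perm (s : K.OrderedSimplex n) (ξ : Equiv.Perm (Fin n)) :
    weight (s.perm ξ) = weight s := by
  refine congrArg (max 1) (Fintype.card_congr (Equiv.subtypeEquivRight
    (p := fun u => {u} ∈ (K.link (s.perm ξ).support).faces)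
    (q := fun u => {u} ∈ (K.link s.support).faces) fun v => ?_))
  rw [support_perm]

open Classical in
theorem sum_local_energy (f : Module.Dual ℝ (K.Chains (n + 1)))
    (hf : f ∘ₗ K.boundary (n + 1) = 0) :
    (n + 1) * ∑ t : K.OrderedSimplex n, (2⁻¹ * ∑ v, ∑ u,
      if (K.link t.support).oneSkeleton.Adj v u then
        (f (oriented (t.cons v)) - f (oriented (t.cons u))) ^ 2 else (0 : ℝ)) ≤
    n * ∑ s : K.OrderedSimplex (n + 1), (weight s : ℝ) * f (oriented s) ^ 2 := by
  have h1 : ∑ t : K.OrderedSimplex n, ∑ v, ∑ u,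
      (if (K.link t.support).oneSkeleton.Adj v u then
        (f (oriented (t.cons v)) - f (oriented (t.cons u))) ^ 2 else (0 : ℝ)) =
      ∑ e : K.OrderedSimplex (n + 2), (faceTerm (fun s => f (oriented s)) 0 e +
        faceTerm (fun s => f (oriented s)) 1 e) ^ 2 := by
    rw [← OrderedSimplex.sum_cons, ← OrderedSimplex.sum_cons]
    refine Finset.sum_congr rfl fun t _ => Finset.sum_congr rfl fun v _ => ?_
    simp only [← coneChain_coe t]
    rw [t.sum_adj v fun u => (f (coneChain t v.1) - f (coneChain t u)) ^ 2]
    refine Finset.sum_congr rfl fun u _ => ?_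
    have hu := mem_link_of_mem_link_cons t v u.2
    simp only [faceTerm, face_zero_cons, face_one_cons_cons t v u hu]
    rw [← coneChain_coe, ← coneChain_coe t ⟨u.1, hu⟩]
    simp [sub_eq_add_neg]
  have h2 : ∑ e : K.OrderedSimplex (n + 2), faceTerm (fun s => f (oriented s)) 0 e ^ 2 ≤
      ∑ s : K.OrderedSimplex (n + 1), (weight s : ℝ) * f (oriented s) ^ 2 := by
    rw [← OrderedSimplex.sum_cons]
    refine Finset.sum_le_sum fun s _ => ?_
    simp only [faceTerm, face_zero_cons, Fin.val_zero, pow_zero, one_mul, Finset.sum_const,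
      Finset.card_univ, nsmul_eq_mul]
    gcongr
    exact le_max_right _ _
  have h3 := (isAlternating_dual f).sum_faceTerm_sq fun e => by
    rw [← dual_boundary_oriented, hf, LinearMap.zero_apply]
  rw [← Finset.mul_sum, h1]
  have h4 := mul_le_mul_of_nonneg_left h2 (Nat.cast_nonneg (α := ℝ) n)
  linarith

theorem betti_le_sum_gamma (K : PreAbstractSimplicialComplex V) (d : ℕ) :
    (K.betti d : ℤ) ≤ ∑ τ ∈ K.simplices ((d : ℤ) - 1),
      (K.link τ).oneSkeleton.gamma (1 - ((d + 1 : ℕ) : ℝ)⁻¹) := by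
  classical
  set a : ℝ := 1 - ((d + 1 : ℕ) : ℝ)⁻¹ with ha
  have had : (d + 1) * a = d := by
    rw [ha]; push_cast; field_simp; ring
  have ha0 : 0 ≤ a := by
    have : (0 : ℝ) < d + 1 := by positivity
    by_contra! h
    nlinarith [Nat.cast_nonneg (α := ℝ) d]
  choose m hm P hP using fun τ : Finset V => (K.link τ).oneSkeleton.exists_linearMap_gamma ha0
  choose o ho using fun τ : {τ // τ ∈ K.simplices ((d : ℤ) - 1)} =>
    exists_support_eq (n := d) τ.2 rfl
  let Φ : Module.Dual ℝ (K.Chains (d + 1)) →ₗ[ℝ]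
      ((Σ τ : {τ // τ ∈ K.simplices ((d : ℤ) - 1)}, Fin (m τ.1)) → ℝ) :=
    LinearMap.pi fun p => LinearMap.proj p.2 ∘ₗ P p.1.1 ∘ₗ
      LinearMap.pi fun v => Module.Dual.eval ℝ _ (coneChain (o p.1) v.1)
  let b : Module.Dual ℝ (K.Chains (d + 1)) →ₗ[ℝ] Module.Dual ℝ (K.Chains (d + 1)) →ₗ[ℝ] ℝ :=
    ∑ s : K.OrderedSimplex (d + 1), (weight s : ℝ) •
      (Module.Dual.eval ℝ _ (oriented s)).smulRight (Module.Dual.eval ℝ _ (oriented s))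
  have hb (φ ψ) : b φ ψ = ∑ s : K.OrderedSimplex (d + 1),
      (weight s : ℝ) * φ (oriented s) * ψ (oriented s) := by
    simp [b, LinearMap.sum_apply, mul_assoc]
  have key := LinearMap.finrank_ker_quotient_range_le (K.boundary d) (K.boundary (d + 1))
    (K.boundary_comp_boundary d) Φ b ?_
  · rw [Fintype.card_sigma] at key
    simp only [Fintype.card_fin] at key
    rw [Finset.sum_coe_sort _ m] at key
    simp only [← hm]
    exact_mod_cast key
  intro φ hcl hΦ hbφ
  have hwalt : IsAlternating fun s : K.OrderedSimplex (d + 1) =>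
      (weight s : ℝ) * φ (oriented s) := fun s ξ => by
    simp only [weight_perm, oriented_perm, map_smul, smul_eq_mul]
    ring
  have hco (t : K.OrderedSimplex d) : ∑ v : {v : V // {v} ∈ (K.link t.support).faces},
      (weight (t.cons v) : ℝ) * φ (oriented (t.cons v)) = 0 := by
    obtain ⟨ψ, hψ⟩ := hwalt.sum_cons.exists_dual
    have h := hbφ ψ
    rw [hb] at h
    simp only [dual_boundary_oriented, hψ] at h
    rw [hwalt.sum_cons.sum_mul_coboundary hwalt] at h
    have hd : ((d : ℝ) + 1) ≠ 0 := by positivity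
    have h' := (mul_eq_zero.1 h).resolve_left hd
    rw [Finset.sum_eq_zero_iff_of_nonneg fun _ _ => mul_self_nonneg _] at h'
    exact mul_self_eq_zero.1 (h' t (Finset.mem_univ _))
  have hPt (t : K.OrderedSimplex d) : P t.support (fun v => φ (oriented (t.cons v))) = 0 := by
    obtain ⟨ξ, hξ⟩ := exists_perm_eq (ho ⟨t.support, support_mem_simplices t⟩)
    have h0 : P t.support
        (fun v => φ (coneChain (o ⟨t.support, support_mem_simplices t⟩) v.1)) = 0 := by
      ext i
      exact congrFun hΦ ⟨⟨t.support, support_mem_simplices t⟩, i⟩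
    have h1 : (fun v => φ (oriented (t.cons v))) = ((Equiv.Perm.sign ξ : ℤ) : ℝ) •
        (fun v : {v : V // {v} ∈ (K.link t.support).faces} =>
          φ (coneChain (o ⟨t.support, support_mem_simplices t⟩) v.1)) := by
      ext v
      rw [Pi.smul_apply, ← map_smul, ← coneChain_perm, hξ, coneChain_coe]
    rw [h1, map_smul, h0, smul_zero]
  have hlocal (t : K.OrderedSimplex d) (hne : (fun v => φ (oriented (t.cons v))) ≠ 0) :
      a * ∑ v, (weight (t.cons v) : ℝ) * φ (oriented (t.cons v)) ^ 2 <
      2⁻¹ * ∑ v, ∑ u, if (K.link t.support).oneSkeleton.Adj v u then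
        (φ (oriented (t.cons v)) - φ (oriented (t.cons u))) ^ 2 else (0 : ℝ) := by
    have h := hP t.support (fun v => φ (oriented (t.cons v)))
    simp only [degree_link] at h
    exact h (hco t) (hPt t) hne
  have hlocal_le (t : K.OrderedSimplex d) :
      a * ∑ v, (weight (t.cons v) : ℝ) * φ (oriented (t.cons v)) ^ 2 ≤
      2⁻¹ * ∑ v, ∑ u, if (K.link t.support).oneSkeleton.Adj v u then
        (φ (oriented (t.cons v)) - φ (oriented (t.cons u))) ^ 2 else (0 : ℝ) := by
    by_cases h : (fun v => φ (oriented (t.cons v))) = 0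
    · have h' (v) : φ (oriented (t.cons v)) = 0 := congrFun h v
      simp [h']
    · exact (hlocal t h).le
  by_contra hφ
  obtain ⟨s, hs⟩ : ∃ s : K.OrderedSimplex (d + 1), φ (oriented s) ≠ 0 := by
    by_contra! h
    exact hφ (dual_ext h)
  obtain ⟨t, v, rfl⟩ := exists_cons_eq s
  have hlt := Finset.sum_lt_sum (fun t _ => hlocal_le t)
    ⟨t, Finset.mem_univ _, hlocal t fun h => hs (congrFun h v)⟩
  rw [← Finset.mul_sum, OrderedSimplex.sum_cons
    (h := fun s => (weight s : ℝ) * φ (oriented s) ^ 2)] at hlt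
  have hle := sum_local_energy φ hcl
  have hd : (0 : ℝ) < d + 1 := by positivity
  have := mul_lt_mul_of_pos_left hlt hd
  rw [← mul_assoc, had] at this
  exact absurd (this.trans_le hle) (lt_irrefl _)

end Local

end PreAbstractSimplicialComplex

theorem mainTheorem3 {V : Type*} [Fintype V] [DecidableEq V] [Nonempty V]
    (X : AbstractSimplicialComplex V) (D : ℕ) (hD : 1 ≤ D) :
    (X.betti (D - 1) : ℤ) ≤
      ∑ τ ∈ X.simplices ((D : ℤ) - 2),
        (X.link τ).oneSkeleton.gamma (1 - (D : ℝ)⁻¹) := by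
  obtain ⟨d, rfl⟩ := Nat.exists_eq_add_of_le' hD
  have h : ((d + 1 : ℕ) : ℤ) - 2 = d - 1 := by push_cast; ring
  rw [h]
  exact X.betti_le_sum_gamma d
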